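/- Let $q$ be a prime power and $n,\ell\in\mathbb N$. Write $A\subseteq\mathcal C$ if every column of the matrix $A\in\mathbb F_q^{n\times b}$ lies in the linear code $\mathcal C\le\mathbb F_q^n$. For a distribution $\tau$ on $\mathbb F_q^b$ let $\mathcal M_{n,\tau}$ be the set of $A\in\mathbb F_q^{n\times b}$ whose empirical row distribution $x\mapsto\frac1n|\{i: A_i=x\}|$ equals $\tau$, let $\dim(\tau)=\dim\operatorname{span}(\operatorname{supp}\tau)$, and $H_q(\tau)=-\sum_v\tau(v)\log_q\tau(v)$. A random code $\mathcal C\le\mathbb F_q^n$ is *$\ell$-locally similar to $\mathrm{RLC}(R)$* if for all $1\le b\le\ell$ and all distributions $\tau$ on $\mathbb F_q^b$ with $\dim(\tau)=b$, $$\mathbb E_{\mathcal C}\big[|\{A\in\mathcal M_{n,\tau}:A\subseteq\mathcal C\}|\big]\le q^{(H_q(\tau)-b(1-R))n}.$$ For $R=k/n$ with $k\in\{0,\dots,n\}$, $\mathrm{RLC}(R)$ is the kernel of a uniformly random matrix in $\mathbb F_q^{(n-k)\times n}$. A family $\mathcal P$ of linear codes in $\mathbb F_q^n$ is an *$\ell$-local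 property* if there is a finite set $T$ of distributions on $\mathbb F_q^\ell$ such that $\mathcal C\in\mathcal P$ iff $A\not\subseteq\mathcal C$ for all $\tau\in T$ and $A\in\mathcal M_{n,\tau}$. Its threshold rate is $$R_{\mathrm{RLC}}(\mathcal P)=\sup\{R=k/n\in[0,1]:\ \Pr[\mathrm{RLC}(R)\in\mathcal P]\ge 1/2\},\qquad \sup\emptyset=0.$$ **Proposition.** (1) Let $R\in[0,1]$ and let $\mathcal C\le\mathbb F_q^n$ be a linear code sampled from some ensemble such that $$\Pr[A\subseteq\mathcal C]\le q^{-n(1-R)b}\quad\text{for all }1\le b\le\ell\text{ and all }A\in\mathbb F_q^{n\times b}\text{ of rank }b.\qquad(*)$$ Then $\mathcal C$ is $\ell$-locally similar to $\mathrm{RLC}(R)$. (2) Let $q=q(n)$ (a prime power) and $\ell=\ell(n)$ be such that $\frac{n}{\log_q n}\big/q^{2\ell}\to\infty$ as $n\to\infty$. Then there is a sequence $\eta_n\to0$, depending only on the sequences $q$ and $\ell$, such that for every $n$, every $R\in[0,1]$, every random linear code $\mathcal C\le\mathbb F_q^n$ satisfying $(*)$, every real $\varepsilon$, and every $\ell$-local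 property $\mathcal P$ of codes in $\mathbb F_q^n$ with $R\le R_{\mathrm{RLC}}(\mathcal P)-\varepsilon$, $$\Pr[\mathcal C\notin\mathcal P]\le q^{-n(\varepsilon-\eta_n)}.$$ -/

import Mathlib

open Filter Topology

universe u

namespace LocalSim

/-- The probability of the event `S` when a point is sampled from the distribution `μ`. -/
noncomputable def prob {α : Type u} (μ : PMF α) (S : Set α) : ℝ :=
  (μ.toOuterMeasure S).toReal

/-- The expectation of `f` under `μ` (used only for finite `α`, where the sum is finite). -/
noncomputable def expect {α : Type u} (μ : PMF α) (f : α → ℝ) : ℝ :=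
  ∑' a, (μ a).toReal * f a

/-- A `q`-ary linear code of block-length `n`: a subspace of `F^n`, where `|F| = q`. -/
abbrev Code (F : Type u) [Field F] (n : ℕ) : Type u := Submodule F (Fin n → F)

/-- `A ⊆ C`: every column of `A` is a codeword of `C`. -/
def Contains {F : Type u} [Field F] {n b : ℕ} (C : Code F n)
    (A : Matrix (Fin n) (Fin b) F) : Prop :=
  ∀ j : Fin b, (fun i => A i j) ∈ C

/-- The empirical row distribution of `A`: the fraction of the rows of `A` that equal `x`. -/
noncomputable def empDist {F : Type u} {n b : ℕ} (A : Matrix (Fin n) (Fin b) F)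
    (x : Fin b → F) : ℝ :=
  ({i : Fin n | (fun j => A i j) = x}.ncard : ℝ) / (n : ℝ)

/-- The set of the `n × b` matrices whose empirical row distribution is `τ`. -/
def typeClass {F : Type u} (n : ℕ) {b : ℕ} (τ : PMF (Fin b → F)) :
    Set (Matrix (Fin n) (Fin b) F) :=
  {A | ∀ x, empDist A x = (τ x).toReal}

/-- `dim τ`, the dimension of the span of the support of `τ`. -/
noncomputable def dimDist {F : Type u} [Field F] {b : ℕ} (τ : PMF (Fin b → F)) : ℕ :=
  Module.finrank F (Submodule.span F τ.support)

/-- The base-`q` entropy of `τ`, where `q = |F|`. -/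
noncomputable def entropy {F : Type u} [Fintype F] {b : ℕ} (τ : PMF (Fin b → F)) : ℝ :=
  -∑ x : Fin b → F, (τ x).toReal * Real.logb (Fintype.card F : ℝ) (τ x).toReal

/-- The random linear code of rate `k / n` (for `k ≤ n`): the kernel of a uniformly random
matrix with `n - k` rows and `n` columns. -/
noncomputable def rlc (F : Type u) [Field F] [Fintype F] (n k : ℕ) : PMF (Code F n) :=
  (PMF.uniformOfFintype (Matrix (Fin (n - k)) (Fin n) F)).map
    (fun H => LinearMap.ker H.mulVecLin)

/-- `P` is an `ℓ`-local property: it is defined by forbidding the matrices whose type lies in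
some finite set `T` of types. -/
def IsLocalProperty {F : Type u} [Field F] {n : ℕ} (ℓ : ℕ) (P : Set (Code F n)) : Prop :=
  ∃ T : Set (PMF (Fin ℓ → F)), T.Finite ∧
    ∀ C : Code F n, C ∈ P ↔ ∀ τ ∈ T, ∀ A ∈ typeClass n τ, ¬ Contains C A

/-- The threshold rate of `P`: the supremum of the rates `k / n` in `[0, 1]` at which the random
linear code satisfies `P` with probability at least `1 / 2` (and `0` if there is none). -/
noncomputable def thresholdRate {F : Type u} [Field F] [Fintype F] {n : ℕ}
    (P : Set (Code F n)) : ℝ :=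
  sSup {R : ℝ | ∃ k : ℕ, k ≤ n ∧ R = (k : ℝ) / (n : ℝ) ∧ 1 / 2 ≤ prob (rlc F n k) P}

/-- The ensemble `μ` of codes in `F^n` is `ℓ`-locally similar to the random linear code of
rate `R`. -/
def IsLocallySimilar {F : Type u} [Field F] [Fintype F] {n : ℕ} (ℓ : ℕ) (R : ℝ)
    (μ : PMF (Code F n)) : Prop :=
  ∀ b : ℕ, 1 ≤ b → b ≤ ℓ → ∀ τ : PMF (Fin b → F), dimDist τ = b →
    expect μ (fun C => (({A ∈ typeClass n τ | Contains C A}.ncard : ℕ) : ℝ)) ≤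
      (Fintype.card F : ℝ) ^ ((entropy τ - (b : ℝ) * (1 - R)) * (n : ℝ))

/-- `Pr[A ⊆ C] ≤ q^{-n(1-R)b}` for all `1 ≤ b ≤ ℓ` and all `n × b` matrices `A` of rank `b`. -/
def HasContainmentBound {F : Type u} [Field F] [Fintype F] {n : ℕ} (ℓ : ℕ) (R : ℝ)
    (μ : PMF (Code F n)) : Prop :=
  ∀ b : ℕ, 1 ≤ b → b ≤ ℓ → ∀ A : Matrix (Fin n) (Fin b) F, A.rank = b →
    prob μ {C | Contains C A} ≤
      (Fintype.card F : ℝ) ^ (-((n : ℝ) * (1 - R) * (b : ℝ)))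

end LocalSim

/-!
The first claim is linearity of expectation: a matrix of type `τ` has rank `dim τ`
(`rank_eq_dimDist`), and there are at most `q ^ (n H(τ))` of them (`card_typeClass_le`).

For the second claim no entropies are needed. The forbidden matrices of a local property form a
union of orbits under row permutations. Let `k / n` be the threshold rate and `m = n - k`. The random
linear code `ker H`, with `H` uniform of size `m × n`, avoids every forbidden orbit with probability
at least `1 / 2`. Let `A` be forbidden and let `X` count the members of its orbit `O` contained in
`ker H`. Since `Pr[H * B = 0] = q ^ (-m * rank B)`, the Cauchy–Schwarz inequality applied to `X` gives
`2 |O| ^ 2 ≤ ∑ q ^ (m * r(B, B'))`, the sum running over the pairs in `O`, where `r(B, B')` is the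
dimension of the intersection of the two column spaces (`two_mul_sq_card_le_sum`). A pair with
`r(B, B') = b ≥ 1` satisfies a relation `B * φ = B' * ψ` of rank `b`. For fixed `φ`, `ψ` and `B` the
number of such `B'` in `O` is at most `|O|` divided by the size of the orbit of `A * ψ`, because
`B' ↦ B' * ψ` is equivariant (`card_fiber_mul_card_rowOrbit_le`). Hence for some `ψ` with
`A * ψ` of rank `b ≥ 1` the orbit of `A * ψ` has at most `q ^ (2 l² + l) * q ^ (m b)` elements
(`exists_rank_mul_eq_card_rowOrbit_le`).

A code containing a member of `O` contains a member of the orbit of `A * ψ`, so the containment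
bound at rate `R ≤ k / n - ε` and a union bound over that small orbit give probability at most
`q ^ (2 l² + l) * q ^ (-n ε)` (`HasContainmentBound.prob_rowOrbit_le`). A union bound over the at most
`(n + 1) ^ (q ^ l)` orbits of `n × l` matrices finishes the argument; these factors make up
`q ^ (n η)` with `η = rateLoss q l n`, which tends to `0` (`tendsto_rateLoss`).
-/

namespace LocalSim

/-! ### Probabilities and expectations -/

lemma toOuterMeasure_le_one {α : Type u} (μ : PMF α) (S : Set α) : μ.toOuterMeasure S ≤ 1 := by
  rw [PMF.toOuterMeasure_apply, ← μ.tsum_coe]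
  exact ENNReal.tsum_le_tsum fun a => Set.indicator_le_self' (fun _ _ => zero_le) a

lemma prob_ne_top {α : Type u} (μ : PMF α) (S : Set α) : μ.toOuterMeasure S ≠ ⊤ :=
  ne_top_of_le_ne_top ENNReal.one_ne_top (toOuterMeasure_le_one μ S)

lemma prob_le_one {α : Type u} (μ : PMF α) (S : Set α) : prob μ S ≤ 1 :=
  ENNReal.toReal_le_of_le_ofReal zero_le_one
    (by simpa using toOuterMeasure_le_one μ S)

lemma prob_mono {α : Type u} (μ : PMF α) {S T : Set α} (h : S ⊆ T) : prob μ S ≤ prob μ T :=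
  ENNReal.toReal_mono (prob_ne_top μ T) (MeasureTheory.measure_mono h)

lemma prob_biUnion_le {α : Type u} {ι : Type*} (μ : PMF α) (I : Finset ι) (S : ι → Set α) :
    prob μ (⋃ i ∈ I, S i) ≤ ∑ i ∈ I, prob μ (S i) := by
  unfold prob
  rw [← ENNReal.toReal_sum fun i _ => prob_ne_top μ (S i)]
  exact ENNReal.toReal_mono (ENNReal.sum_ne_top.2 fun i _ => prob_ne_top μ (S i))
    (MeasureTheory.measure_biUnion_finset_le I S)

open Classical in
lemma prob_eq_sum {α : Type u} [Fintype α] (μ : PMF α) (S : Set α) :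
    prob μ S = ∑ a, if a ∈ S then (μ a).toReal else 0 := by
  unfold prob
  rw [PMF.toOuterMeasure_apply_fintype, ENNReal.toReal_sum]
  · refine Finset.sum_congr rfl fun a _ => ?_
    by_cases h : a ∈ S <;> simp [h]
  · intro a _
    by_cases h : a ∈ S <;> simp [h, μ.apply_ne_top]

/-- Linearity of expectation for a random count. -/
lemma expect_ncard {α : Type u} {β : Type*} [Finite α] [Fintype β] (μ : PMF α)
    (S : Set β) (r : α → β → Prop) :
    expect μ (fun a => (({B ∈ S | r a B}.ncard : ℕ) : ℝ)) =
      ∑ B ∈ S.toFinite.toFinset, prob μ {a | r a B} := by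
  classical
  have := Fintype.ofFinite α
  have h : ∀ a, (({B ∈ S | r a B}.ncard : ℕ) : ℝ) =
      ∑ B ∈ S.toFinite.toFinset, if r a B then 1 else 0 := by
    intro a
    rw [Finset.sum_boole, Set.ncard_eq_toFinset_card']
    congr 2
    ext B
    simp
  simp only [expect, h, tsum_fintype, Finset.mul_sum, prob_eq_sum]
  rw [Finset.sum_comm]
  simp

/-! ### Size and rank of a type class -/

section TypeClass

variable {F : Type u} {n b : ℕ}

/-- For `n = 0` the division in `empDist` gives the zero function, which is not a distribution, so
the type class is empty. -/
lemma natCast_pos_of_mem_typeClass {τ : PMF (Fin b → F)} {A : Matrix (Fin n) (Fin b) F}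
    (hA : A ∈ typeClass n τ) : (0 : ℝ) < n := by
  rcases Nat.eq_zero_or_pos n with rfl | h
  · exfalso
    obtain ⟨x, hx⟩ := τ.support_nonempty
    have h0 : (τ x).toReal = 0 := by rw [← hA x]; simp [empDist]
    exact (ENNReal.toReal_ne_zero.2 ⟨(τ.mem_support_iff x).1 hx, τ.apply_ne_top x⟩) h0
  · exact_mod_cast h

lemma ncard_rows_eq {τ : PMF (Fin b → F)} {A : Matrix (Fin n) (Fin b) F}
    (hA : A ∈ typeClass n τ) (x : Fin b → F) :
    ({i : Fin n | (fun j => A i j) = x}.ncard : ℝ) = n * (τ x).toReal := by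
  have hn := natCast_pos_of_mem_typeClass hA
  rw [← hA x, empDist]
  field_simp

lemma range_row_eq_support {τ : PMF (Fin b → F)} {A : Matrix (Fin n) (Fin b) F}
    (hA : A ∈ typeClass n τ) : Set.range A.row = τ.support := by
  have hn := natCast_pos_of_mem_typeClass hA
  ext x
  rw [PMF.mem_support_iff, ← not_iff_not, not_not]
  have h1 : τ x = 0 ↔ (τ x).toReal = 0 := by
    simp [ENNReal.toReal_eq_zero_iff, τ.apply_ne_top x]
  have h2 : (τ x).toReal = 0 ↔ ({i : Fin n | (fun j => A i j) = x}.ncard : ℝ) = 0 := by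
    rw [ncard_rows_eq hA x]; simp [hn.ne']
  rw [h1, h2, Nat.cast_eq_zero, Set.ncard_eq_zero (Set.toFinite _),
    Set.eq_empty_iff_forall_notMem]
  simp only [Set.mem_range, not_exists, Set.mem_ofPred_eq]
  rfl

lemma rank_eq_dimDist [Field F] {τ : PMF (Fin b → F)} {A : Matrix (Fin n) (Fin b) F}
    (hA : A ∈ typeClass n τ) : A.rank = dimDist τ := by
  rw [Matrix.rank_eq_finrank_span_row, range_row_eq_support hA, dimDist]

/-- All matrices of type `τ` have probability exactly `q ^ (-n H(τ))` when the rows are drawn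
independently from `τ`. -/
lemma prod_row_eq_rpow_entropy [Field F] [Fintype F] {τ : PMF (Fin b → F)}
    {A : Matrix (Fin n) (Fin b) F} (hA : A ∈ typeClass n τ) :
    ∏ i, (τ (A.row i)).toReal = (Fintype.card F : ℝ) ^ (-(entropy τ * n)) := by
  classical
  have hq1 : (1 : ℝ) < Fintype.card F := by exact_mod_cast Fintype.one_lt_card
  have hq : (0 : ℝ) < Fintype.card F := zero_lt_one.trans hq1
  rw [← Finset.prod_fiberwise Finset.univ A.row]
  have hx : ∀ x : Fin b → F, ∏ i with A.row i = x, (τ (A.row i)).toReal =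
      (Fintype.card F : ℝ) ^ ((n : ℝ) * ((τ x).toReal *
        Real.logb (Fintype.card F : ℝ) (τ x).toReal)) := by
    intro x
    have hc : ((Finset.univ.filter fun i => A.row i = x).card : ℝ) = n * (τ x).toReal := by
      rw [← ncard_rows_eq hA x, Set.ncard_eq_toFinset_card']
      congr 2
      ext i
      simp only [Finset.mem_filter, Finset.mem_univ, true_and, Set.mem_toFinset,
        Set.mem_ofPred_eq]
      rfl
    rw [Finset.prod_congr rfl (g := fun _ => (τ x).toReal)
      (fun i hi => by rw [(Finset.mem_filter.1 hi).2]), Finset.prod_const]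
    rcases (ENNReal.toReal_nonneg (a := τ x)).eq_or_lt with h0 | h0
    · have : (Finset.univ.filter fun i => A.row i = x).card = 0 := by
        rw [← h0, mul_zero] at hc
        exact_mod_cast hc
      rw [this, ← h0]
      simp
    · rw [← Real.rpow_natCast, hc]
      conv_lhs => rw [← Real.rpow_logb hq hq1.ne' h0]
      rw [← Real.rpow_mul hq.le, Real.rpow_logb hq hq1.ne' h0]
      ring_nf
  rw [Finset.prod_congr rfl fun x _ => hx x, ← Real.rpow_sum_of_pos hq, entropy,
    ← Finset.mul_sum]
  ring_nf

lemma card_typeClass_le [Field F] [Fintype F] (τ : PMF (Fin b → F)) :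
    ((typeClass n τ).toFinite.toFinset.card : ℝ) ≤
      (Fintype.card F : ℝ) ^ (entropy τ * n) := by
  classical
  have hq : (0 : ℝ) < Fintype.card F := by exact_mod_cast Fintype.card_pos
  have hsum : ∑ x, (τ x).toReal = 1 := by
    rw [← ENNReal.toReal_sum fun x _ => τ.apply_ne_top x, ← tsum_fintype (L := .unconditional _),
      τ.tsum_coe]
    rfl
  have h1 : ∑ A ∈ (typeClass n τ).toFinite.toFinset, ∏ i, (τ (A.row i)).toReal ≤ 1 := by
    have hp := Fintype.sum_pow (fun x => (τ x).toReal) n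
    rw [hsum, one_pow] at hp
    rw [hp]
    exact Finset.sum_le_sum_of_subset_of_nonneg (Finset.subset_univ _)
      fun _ _ _ => Finset.prod_nonneg fun _ _ => ENNReal.toReal_nonneg
  rw [Finset.sum_congr rfl fun A hA => prod_row_eq_rpow_entropy
    ((Set.Finite.mem_toFinset _).1 hA), Finset.sum_const, nsmul_eq_mul,
    Real.rpow_neg hq.le, ← div_eq_mul_inv, div_le_one (Real.rpow_pos_of_pos hq _)] at h1
  exact h1

end TypeClass

/-- Linearity of expectation, together with the bound `q ^ (n H(τ))` on the size of a type
class. -/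
theorem HasContainmentBound.isLocallySimilar {F : Type u} [Field F] [Fintype F] {n ℓ : ℕ} {R : ℝ}
    {μ : PMF (Code F n)} (h : HasContainmentBound ℓ R μ) : IsLocallySimilar ℓ R μ := by
  intro b hb hbl τ hτ
  have hq : (0 : ℝ) < Fintype.card F := by exact_mod_cast Fintype.card_pos
  rw [expect_ncard μ (typeClass n τ) (fun C A => Contains C A)]
  calc _ ≤ ∑ _A ∈ (typeClass n τ).toFinite.toFinset,
        (Fintype.card F : ℝ) ^ (-((n : ℝ) * (1 - R) * (b : ℝ))) :=
        Finset.sum_le_sum fun A hA =>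
          h b hb hbl A ((rank_eq_dimDist ((Set.Finite.mem_toFinset _).1 hA)).trans hτ)
    _ ≤ (Fintype.card F : ℝ) ^ (entropy τ * n) *
        (Fintype.card F : ℝ) ^ (-((n : ℝ) * (1 - R) * (b : ℝ))) := by
        rw [Finset.sum_const, nsmul_eq_mul]
        exact mul_le_mul_of_nonneg_right (card_typeClass_le τ) (Real.rpow_nonneg hq.le _)
    _ = _ := by
        rw [← Real.rpow_add hq]
        ring_nf

/-! ### Row permutations of a matrix -/

section RowOrbit

variable {F : Type u} {n l b : ℕ}

open Classical in
/-- The matrices obtained from `A` by permuting its rows, i.e. those with the same empirical row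
distribution as `A`. -/
noncomputable def rowOrbit {ι : Type*} (A : Matrix (Fin n) ι F) :
    Finset (Matrix (Fin n) ι F) :=
  Finset.univ.image fun σ : Equiv.Perm (Fin n) => A.submatrix σ id

lemma mem_rowOrbit {A B : Matrix (Fin n) (Fin l) F} :
    B ∈ rowOrbit A ↔ ∃ σ : Equiv.Perm (Fin n), A.submatrix σ id = B := by
  simp [rowOrbit]

lemma self_mem_rowOrbit (A : Matrix (Fin n) (Fin l) F) : A ∈ rowOrbit A :=
  mem_rowOrbit.2 ⟨1, by ext; rfl⟩

lemma submatrix_mem_rowOrbit {A B : Matrix (Fin n) (Fin l) F} (hB : B ∈ rowOrbit A)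
    (σ : Equiv.Perm (Fin n)) : B.submatrix σ id ∈ rowOrbit A := by
  obtain ⟨τ, rfl⟩ := mem_rowOrbit.1 hB
  exact mem_rowOrbit.2 ⟨σ.trans τ, by ext; rfl⟩

lemma submatrix_mul_right [Field F] (A : Matrix (Fin n) (Fin l) F) (ψ : Matrix (Fin l) (Fin b) F)
    (σ : Equiv.Perm (Fin n)) : A.submatrix σ id * ψ = (A * ψ).submatrix σ id := by
  ext i j
  simp [Matrix.mul_apply]

lemma mul_mem_rowOrbit [Field F] {A B : Matrix (Fin n) (Fin l) F} (hB : B ∈ rowOrbit A)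
    (ψ : Matrix (Fin l) (Fin b) F) : B * ψ ∈ rowOrbit (A * ψ) := by
  obtain ⟨σ, rfl⟩ := mem_rowOrbit.1 hB
  exact mem_rowOrbit.2 ⟨σ, (submatrix_mul_right A ψ σ).symm⟩

lemma rank_eq_of_mem_rowOrbit [Field F] {A B : Matrix (Fin n) (Fin l) F} (hB : B ∈ rowOrbit A) :
    B.rank = A.rank := by
  obtain ⟨σ, rfl⟩ := mem_rowOrbit.1 hB
  exact Matrix.rank_submatrix A σ (Equiv.refl _)

/-- The map `B ↦ B * ψ` from the orbit of `A` onto the orbit of `A * ψ` is equivariant, so its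
fibres over the points of the latter have equal size. -/
lemma card_fiber_mul_card_rowOrbit_le [Field F] [DecidableEq F] (A : Matrix (Fin n) (Fin l) F)
    (ψ : Matrix (Fin l) (Fin b) F) (D : Matrix (Fin n) (Fin b) F) :
    ((rowOrbit A).filter fun B => B * ψ = D).card * (rowOrbit (A * ψ)).card ≤
      (rowOrbit A).card := by
  by_cases hD : D ∈ rowOrbit (A * ψ)
  · rw [Finset.card_eq_sum_card_fiberwise (f := fun B => B * ψ) (s := rowOrbit A)
      (t := rowOrbit (A * ψ)) (fun B hB => mul_mem_rowOrbit hB ψ), mul_comm, ← smul_eq_mul]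
    refine Finset.card_nsmul_le_sum _ _ _ fun D' hD' => ?_
    obtain ⟨σ, rfl⟩ := mem_rowOrbit.1 hD
    obtain ⟨τ, rfl⟩ := mem_rowOrbit.1 hD'
    refine Finset.card_le_card_of_injOn (fun B => B.submatrix (τ.trans σ.symm) id) ?_ ?_
    · intro B hB
      obtain ⟨hB, hBψ⟩ := Finset.mem_filter.1 hB
      refine Finset.mem_filter.2 ⟨submatrix_mem_rowOrbit hB _, ?_⟩
      rw [submatrix_mul_right, hBψ]
      ext i j
      simp
    · intro B _ B' _ h
      ext i j
      have := congrFun (congrFun h ((τ.trans σ.symm).symm i)) j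
      simpa using this
  · rw [Finset.card_eq_zero.2, zero_mul]
    · exact Nat.zero_le _
    · refine Finset.filter_eq_empty_iff.2 fun B hB h => hD ?_
      exact h ▸ mul_mem_rowOrbit hB ψ

lemma mem_rowOrbit_of_card_eq [DecidableEq F] {A B : Matrix (Fin n) (Fin l) F}
    (h : ∀ x, (Finset.univ.filter fun i => A.row i = x).card =
      (Finset.univ.filter fun i => B.row i = x).card) : B ∈ rowOrbit A := by
  have e : ∀ x, {i // B.row i = x} ≃ {i // A.row i = x} := fun x =>
    Fintype.equivOfCardEq (by rw [Fintype.card_subtype, Fintype.card_subtype, h x])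
  refine mem_rowOrbit.2 ⟨Equiv.ofFiberEquiv e, ?_⟩
  ext i j
  exact congrFun (Equiv.ofFiberEquiv_map e i) j

end RowOrbit

/-! ### Parity-check matrices annihilating a given matrix -/

section Annihilators

variable {F : Type u} [Field F] {n l : ℕ}

lemma card_matrix_fin (F : Type u) [Fintype F] (a b : ℕ) :
    Fintype.card (Matrix (Fin a) (Fin b) F) = Fintype.card F ^ (a * b) := by
  rw [Fintype.card_congr (Matrix.of (m := Fin a) (n := Fin b) (α := F)).symm, Fintype.card_fun,
    Fintype.card_fun, Fintype.card_fin, Fintype.card_fin, ← pow_mul, mul_comm]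

lemma card_annihilators_mul [Fintype F] [DecidableEq F] {ι : Type*} [Fintype ι] (m : ℕ)
    (B : Matrix (Fin n) ι F) :
    (Finset.univ.filter fun H : Matrix (Fin m) (Fin n) F => H * B = 0).card *
      Fintype.card F ^ (m * B.rank) = Fintype.card F ^ (m * n) := by
  classical
  have hk : B.rank + Module.finrank F (LinearMap.ker B.vecMulLinear) = n := by
    have h := LinearMap.finrank_range_add_finrank_ker B.vecMulLinear
    rw [Module.finrank_fin_fun] at h
    rwa [← Matrix.mulVecLin_transpose, ← Matrix.rank, Matrix.rank_transpose,
      Matrix.mulVecLin_transpose] at h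
  have hc : (Finset.univ.filter fun H : Matrix (Fin m) (Fin n) F => H * B = 0).card =
      Fintype.card (Fin m → LinearMap.ker B.vecMulLinear) := by
    rw [← Fintype.card_subtype]
    refine Fintype.card_congr
      { toFun := fun H i => ⟨H.1 i, ?_⟩
        invFun := fun v => ⟨Matrix.of fun i => (v i).1, ?_⟩
        left_inv := fun H => rfl
        right_inv := fun v => rfl }
    · ext j
      exact congrFun (congrFun H.2 i) j
    · ext i j
      exact congrFun (LinearMap.mem_ker.1 (v i).2) j
  rw [hc, Fintype.card_fun, Module.card_eq_pow_finrank (K := F), Fintype.card_fin, ← pow_mul,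
    ← pow_add]
  congr 1
  conv_rhs => rw [← hk]
  ring

lemma rank_fromCols_add (B B' : Matrix (Fin n) (Fin l) F) :
    (B.fromCols B').rank + Module.finrank F
      ↥(LinearMap.range B.mulVecLin ⊓ LinearMap.range B'.mulVecLin) = B.rank + B'.rank := by
  have h : LinearMap.range (B.fromCols B').mulVecLin =
      LinearMap.range B.mulVecLin ⊔ LinearMap.range B'.mulVecLin := by
    simp only [Matrix.range_mulVecLin]
    rw [← Submodule.span_union]
    congr 1
    ext x
    simp only [Set.mem_range, Set.mem_union, Sum.exists]
    rfl
  rw [Matrix.rank, h, Submodule.finrank_sup_add_finrank_inf_eq]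
  rfl

/-- If the column spaces of `B` and `B'` meet in dimension `r`, a basis of the intersection can be
written both as `B * φ` and as `B' * ψ`. -/
lemma exists_mul_eq_mul_rank (B B' : Matrix (Fin n) (Fin l) F) {r : ℕ}
    (hr : Module.finrank F
      ↥(LinearMap.range B.mulVecLin ⊓ LinearMap.range B'.mulVecLin) = r) :
    ∃ φ ψ : Matrix (Fin l) (Fin r) F, B * φ = B' * ψ ∧ (B' * ψ).rank = r := by
  let W := LinearMap.range B.mulVecLin ⊓ LinearMap.range B'.mulVecLin
  let e : Module.Basis (Fin r) F W := Module.finBasisOfFinrankEq F W hr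
  have h1 : ∀ j, ∃ v, B.mulVecLin v = (e j : Fin n → F) := fun j => (e j).2.1
  have h2 : ∀ j, ∃ v, B'.mulVecLin v = (e j : Fin n → F) := fun j => (e j).2.2
  choose v hv using h1
  choose w hw using h2
  have hφ : B * (Matrix.of v).transpose = (Matrix.of fun j => (e j : Fin n → F)).transpose := by
    ext i j
    exact congrFun (hv j) i
  have hψ : B' * (Matrix.of w).transpose = (Matrix.of fun j => (e j : Fin n → F)).transpose := by
    ext i j
    exact congrFun (hw j) i
  refine ⟨(Matrix.of v).transpose, (Matrix.of w).transpose, hφ.trans hψ.symm, ?_⟩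
  rw [hψ, Matrix.rank_transpose]
  have hli : LinearIndependent F (fun j => (e j : Fin n → F)) :=
    e.linearIndependent.map' W.subtype (Submodule.ker_subtype W)
  have := LinearIndependent.rank_matrix (M := Matrix.of fun j => (e j : Fin n → F)) hli
  simpa using this

end Annihilators

/-! ### The second moment -/

section SecondMoment

variable {F : Type u} [Field F] [Fintype F] [DecidableEq F] {n l : ℕ}

/-- The second-moment inequality for the number of rearrangements of `A` annihilated by a uniformly
random `m × n` matrix: if with probability at least `1 / 2` there are none, the correlations
between pairs of rearrangements must be large. -/
lemma two_mul_sq_card_le_sum (m : ℕ) (A : Matrix (Fin n) (Fin l) F)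
    (h : 2 * (Finset.univ.filter fun H : Matrix (Fin m) (Fin n) F =>
      ∃ B ∈ rowOrbit A, H * B = 0).card ≤ Fintype.card F ^ (m * n)) :
    2 * (rowOrbit A).card ^ 2 ≤ ∑ B ∈ rowOrbit A, ∑ B' ∈ rowOrbit A,
      Fintype.card F ^ (m * Module.finrank F
        ↥(LinearMap.range B.mulVecLin ⊓ LinearMap.range B'.mulVecLin)) := by
  set q := Fintype.card F
  have hq : 0 < q := Fintype.card_pos
  set O := rowOrbit A
  set s := Finset.univ.filter fun H : Matrix (Fin m) (Fin n) F => ∃ B ∈ O, H * B = 0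
  let X : Matrix (Fin m) (Fin n) F → ℕ := fun H => ∑ B ∈ O, if H * B = 0 then 1 else 0
  set r : Matrix (Fin n) (Fin l) F → Matrix (Fin n) (Fin l) F → ℕ := fun B B' =>
    Module.finrank F ↥(LinearMap.range B.mulVecLin ⊓ LinearMap.range B'.mulVecLin)
  have hX0 : ∀ H ∉ s, X H = 0 := by
    intro H hH
    refine Finset.sum_eq_zero fun B hB => if_neg fun h0 => hH ?_
    exact Finset.mem_filter.2 ⟨Finset.mem_univ _, B, hB, h0⟩
  -- first and second moments of `X`, cleared of denominators
  have h1 : (∑ H ∈ s, X H) * q ^ (m * A.rank) = O.card * q ^ (m * n) := by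
    rw [Finset.sum_subset (Finset.subset_univ s) fun H _ hH => hX0 H hH, Finset.sum_comm,
      Finset.sum_mul, Finset.sum_congr rfl (g := fun _ => q ^ (m * n)), Finset.sum_const,
      smul_eq_mul]
    intro B hB
    rw [← Finset.card_filter, ← rank_eq_of_mem_rowOrbit hB, card_annihilators_mul]
  have h2 : (∑ H ∈ s, X H ^ 2) * q ^ (2 * (m * A.rank)) =
      (∑ B ∈ O, ∑ B' ∈ O, q ^ (m * r B B')) * q ^ (m * n) := by
    rw [Finset.sum_subset (Finset.subset_univ s) fun H _ hH => by rw [hX0 H hH]; rfl]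
    have hsq : ∀ H, X H ^ 2 =
        ∑ B ∈ O, ∑ B' ∈ O, if H * B.fromCols B' = 0 then 1 else 0 := by
      intro H
      rw [sq, Finset.sum_mul_sum]
      refine Finset.sum_congr rfl fun B _ => Finset.sum_congr rfl fun B' _ => ?_
      have hiff : H * B.fromCols B' = 0 ↔ H * B = 0 ∧ H * B' = 0 := by
        rw [Matrix.mul_fromCols, ← Matrix.fromCols_zero, Matrix.fromCols_ext_iff]
      simp only [hiff, ite_and]
      split_ifs <;> rfl
    simp only [hsq]
    rw [Finset.sum_comm, Finset.sum_mul, Finset.sum_mul]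
    refine Finset.sum_congr rfl fun B hB => ?_
    rw [Finset.sum_comm, Finset.sum_mul, Finset.sum_mul]
    refine Finset.sum_congr rfl fun B' hB' => ?_
    have hr : (B.fromCols B').rank + r B B' = A.rank + A.rank := by
      rw [rank_fromCols_add, rank_eq_of_mem_rowOrbit hB, rank_eq_of_mem_rowOrbit hB']
    rw [← Finset.card_filter, ← card_annihilators_mul m (B.fromCols B'), two_mul, ← mul_add, ← hr,
      mul_add, pow_add]
    ring
  have hcs := sq_sum_le_card_mul_sum_sq (s := s) (f := X)
  have hpos : 0 < (q ^ (m * n)) ^ 2 := by positivity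
  refine Nat.le_of_mul_le_mul_right (c := (q ^ (m * n)) ^ 2) ?_ hpos
  calc 2 * O.card ^ 2 * (q ^ (m * n)) ^ 2 = 2 * ((∑ H ∈ s, X H) * q ^ (m * A.rank)) ^ 2 := by
        rw [h1]; ring
    _ = 2 * (∑ H ∈ s, X H) ^ 2 * q ^ (2 * (m * A.rank)) := by ring
    _ ≤ 2 * (s.card * ∑ H ∈ s, X H ^ 2) * q ^ (2 * (m * A.rank)) := by
        gcongr
        exact_mod_cast hcs
    _ = 2 * s.card * ((∑ H ∈ s, X H ^ 2) * q ^ (2 * (m * A.rank))) := by ring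
    _ ≤ q ^ (m * n) * ((∑ B ∈ O, ∑ B' ∈ O, q ^ (m * r B B')) * q ^ (m * n)) := by
        rw [h2]
        gcongr
    _ = _ := by ring

/-- If a random parity-check matrix annihilates no rearrangement of `A` with probability at least
`1 / 2`, then the first-moment method already explains this, up to the factor `q ^ (2 l² + l)`, for
some full-rank linear image `A * ψ` of `A`. -/
theorem exists_rank_mul_eq_card_rowOrbit_le (m : ℕ) (A : Matrix (Fin n) (Fin l) F)
    (h : 2 * (Finset.univ.filter fun H : Matrix (Fin m) (Fin n) F =>
      ∃ B ∈ rowOrbit A, H * B = 0).card ≤ Fintype.card F ^ (m * n)) :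
    ∃ b, 1 ≤ b ∧ b ≤ l ∧ ∃ ψ : Matrix (Fin l) (Fin b) F, (A * ψ).rank = b ∧
      (rowOrbit (A * ψ)).card ≤ Fintype.card F ^ (2 * l ^ 2 + l) * Fintype.card F ^ (m * b) := by
  by_contra! hcon
  have hsum := two_mul_sq_card_le_sum m A h
  set q := Fintype.card F
  have hq : 1 < q := Fintype.one_lt_card
  set O := rowOrbit A
  set N := q ^ (2 * l ^ 2 + l)
  have hO : 0 < O.card := Finset.card_pos.2 ⟨A, self_mem_rowOrbit A⟩
  -- the pairs whose column spaces meet nontrivially are indexed by the relations `B * φ = B' * ψ`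
  have hpair : ∀ B ∈ O, ∀ B' ∈ O, q ^ (m * Module.finrank F
        ↥(LinearMap.range B.mulVecLin ⊓ LinearMap.range B'.mulVecLin)) ≤
      1 + ∑ b ∈ Finset.Icc 1 l, ∑ φ : Matrix (Fin l) (Fin b) F, ∑ ψ : Matrix (Fin l) (Fin b) F,
        if B' * ψ = B * φ ∧ (A * ψ).rank = b then q ^ (m * b) else 0 := by
    intro B _ B' hB'
    obtain ⟨r, hr⟩ : ∃ r, Module.finrank F
      ↥(LinearMap.range B.mulVecLin ⊓ LinearMap.range B'.mulVecLin) = r := ⟨_, rfl⟩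
    rw [hr]
    rcases Nat.eq_zero_or_pos r with rfl | hpos
    · simp
    obtain ⟨φ, ψ, h1, h2⟩ := exists_mul_eq_mul_rank B B' hr
    have h2' : (A * ψ).rank = r := by
      rw [← rank_eq_of_mem_rowOrbit (mul_mem_rowOrbit hB' ψ), h2]
    have hrl : r ∈ Finset.Icc 1 l := by
      refine Finset.mem_Icc.2 ⟨hpos, ?_⟩
      calc r = (A * ψ).rank := h2'.symm
        _ ≤ A.rank := Matrix.rank_mul_le_left _ _
        _ ≤ l := by simpa using A.rank_le_card_width
    refine le_trans ?_ (Nat.le_add_left _ 1)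
    refine le_trans ?_ (Finset.single_le_sum (fun _ _ => Nat.zero_le _) hrl)
    refine le_trans ?_ (Finset.single_le_sum (fun _ _ => Nat.zero_le _) (Finset.mem_univ φ))
    refine le_trans ?_ (Finset.single_le_sum (fun _ _ => Nat.zero_le _) (Finset.mem_univ ψ))
    rw [if_pos ⟨h1.symm, h2'⟩]
  have hone : ∀ b ∈ Finset.Icc 1 l, ∀ φ ψ : Matrix (Fin l) (Fin b) F, ∀ B ∈ O,
      N * ∑ B' ∈ O, (if B' * ψ = B * φ ∧ (A * ψ).rank = b then q ^ (m * b) else 0) ≤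
        O.card := by
    intro b hb φ ψ B _
    obtain ⟨hb1, hbl⟩ := Finset.mem_Icc.1 hb
    by_cases hrk : (A * ψ).rank = b
    · simp only [hrk, and_true]
      rw [← Finset.sum_filter, Finset.sum_const, smul_eq_mul]
      calc _ = (O.filter fun B' => B' * ψ = B * φ).card * (N * q ^ (m * b)) := by ring
        _ ≤ (O.filter fun B' => B' * ψ = B * φ).card * (rowOrbit (A * ψ)).card :=
          Nat.mul_le_mul_left _ (hcon b hb1 hbl ψ hrk).le
        _ ≤ O.card := card_fiber_mul_card_rowOrbit_le A ψ _
    · simp [hrk]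
  have hcardM : ∀ b, b ∈ Finset.Icc 1 l →
      Fintype.card (Matrix (Fin l) (Fin b) F) ≤ q ^ (l ^ 2) := by
    intro b hb
    rw [card_matrix_fin]
    refine Nat.pow_le_pow_right hq.le ?_
    rw [sq]
    exact Nat.mul_le_mul_left _ (Finset.mem_Icc.1 hb).2
  -- `N` exceeds the number of triples `(b, φ, ψ)`, which contradicts `hsum` by averaging
  have hlt : l * (q ^ (l ^ 2) * q ^ (l ^ 2)) < N := by
    have : N = q ^ l * (q ^ (l ^ 2) * q ^ (l ^ 2)) := by
      simp only [N]
      ring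
    rw [this]
    exact Nat.mul_lt_mul_of_pos_right (Nat.lt_pow_self hq) (by positivity)
  have key : N * (2 * O.card ^ 2) ≤
      N * O.card ^ 2 + l * (q ^ (l ^ 2) * q ^ (l ^ 2)) * O.card ^ 2 := by
    calc N * (2 * O.card ^ 2) ≤ N * ∑ B ∈ O, ∑ B' ∈ O, (1 + ∑ b ∈ Finset.Icc 1 l,
          ∑ φ : Matrix (Fin l) (Fin b) F, ∑ ψ : Matrix (Fin l) (Fin b) F,
          if B' * ψ = B * φ ∧ (A * ψ).rank = b then q ^ (m * b) else 0) := by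
          refine Nat.mul_le_mul_left _ (hsum.trans ?_)
          exact Finset.sum_le_sum fun B hB => Finset.sum_le_sum fun B' hB' => hpair B hB B' hB'
      _ = N * O.card ^ 2 + ∑ b ∈ Finset.Icc 1 l,
          ∑ φ : Matrix (Fin l) (Fin b) F, ∑ ψ : Matrix (Fin l) (Fin b) F, ∑ B ∈ O,
          N * ∑ B' ∈ O,
            if B' * ψ = B * φ ∧ (A * ψ).rank = b then q ^ (m * b) else 0 := by
          simp only [Finset.sum_add_distrib, Finset.sum_const, smul_eq_mul, mul_one, mul_add, sq]
          congr 1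
          simp only [Finset.mul_sum]
          calc _ = ∑ B ∈ O, ∑ b ∈ Finset.Icc 1 l, ∑ φ : Matrix (Fin l) (Fin b) F,
                ∑ ψ : Matrix (Fin l) (Fin b) F, ∑ B' ∈ O,
                N * (if B' * ψ = B * φ ∧ (A * ψ).rank = b then q ^ (m * b) else 0) := by
                refine Finset.sum_congr rfl fun B _ => ?_
                rw [Finset.sum_comm]
                refine Finset.sum_congr rfl fun b _ => ?_
                rw [Finset.sum_comm]
                refine Finset.sum_congr rfl fun φ _ => ?_
                rw [Finset.sum_comm]
            _ = _ := by
                rw [Finset.sum_comm]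
                refine Finset.sum_congr rfl fun b _ => ?_
                rw [Finset.sum_comm]
                refine Finset.sum_congr rfl fun φ _ => ?_
                rw [Finset.sum_comm]
      _ ≤ N * O.card ^ 2 + ∑ b ∈ Finset.Icc 1 l,
          ∑ φ : Matrix (Fin l) (Fin b) F, ∑ ψ : Matrix (Fin l) (Fin b) F, ∑ B ∈ O, O.card := by
          gcongr with b hb φ _ ψ _ B hB
          exact hone b hb φ ψ B hB
      _ ≤ N * O.card ^ 2 + ∑ b ∈ Finset.Icc 1 l, q ^ (l ^ 2) * q ^ (l ^ 2) * O.card ^ 2 := by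
          gcongr with b hb
          simp only [Finset.sum_const, smul_eq_mul, Finset.card_univ]
          rw [← sq, ← mul_assoc]
          have := hcardM b hb
          gcongr
      _ = _ := by
          rw [Finset.sum_const, Nat.card_Icc, smul_eq_mul]
          simp only [Nat.add_sub_cancel]
          ring
  have : l * (q ^ (l ^ 2) * q ^ (l ^ 2)) * O.card ^ 2 < N * O.card ^ 2 :=
    Nat.mul_lt_mul_of_pos_right hlt (by positivity)
  linarith

end SecondMoment

/-! ### From the threshold rate to a failure probability -/

section Threshold

variable {F : Type u} {n l : ℕ}

lemma contains_ker_iff [Field F] {m : ℕ} (H : Matrix (Fin m) (Fin n) F)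
    (A : Matrix (Fin n) (Fin l) F) :
    Contains (LinearMap.ker H.mulVecLin) A ↔ H * A = 0 := by
  constructor
  · intro h
    ext i j
    exact congrFun (LinearMap.mem_ker.1 (h j)) i
  · intro h j
    refine LinearMap.mem_ker.2 ?_
    ext i
    exact congrFun (congrFun h i) j

lemma Contains.mul_right [Field F] {C : Code F n} {A : Matrix (Fin n) (Fin l) F}
    (h : Contains C A) {b : ℕ}
    (ψ : Matrix (Fin l) (Fin b) F) : Contains C (A * ψ) := by
  intro j
  have : (fun i => (A * ψ) i j) = ∑ t, ψ t j • fun i => A i t := by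
    ext i
    simp [Matrix.mul_apply, mul_comm]
  rw [this]
  exact C.sum_mem fun t _ => C.smul_mem _ (h t)

open Classical in
lemma prob_rlc [Field F] [Fintype F] (k : ℕ) (S : Set (Code F n)) :
    prob (rlc F n k) S = ((Finset.univ.filter fun H : Matrix (Fin (n - k)) (Fin n) F =>
      LinearMap.ker H.mulVecLin ∈ S).card : ℝ) / (Fintype.card F : ℝ) ^ ((n - k) * n) := by
  rw [prob, rlc, PMF.toOuterMeasure_map_apply, PMF.toOuterMeasure_uniformOfFintype_apply,
    ENNReal.toReal_div, ENNReal.toReal_natCast, ENNReal.toReal_natCast, card_matrix_fin, Nat.cast_pow,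
    Fintype.card_ofFinset]
  rfl

lemma empDist_eq_of_mem_rowOrbit {A B : Matrix (Fin n) (Fin l) F} (hB : B ∈ rowOrbit A) :
    empDist B = empDist A := by
  obtain ⟨σ, rfl⟩ := mem_rowOrbit.1 hB
  ext x
  have h : {i : Fin n | (fun j => A i j) = x} =
      σ '' {i : Fin n | (fun j => A.submatrix σ id i j) = x} := by
    ext i
    constructor
    · intro hi
      refine ⟨σ.symm i, ?_, by simp⟩
      simpa using hi
    · rintro ⟨i', hi', rfl⟩
      simpa using hi'
  rw [empDist, empDist, h, Set.ncard_image_of_injective _ σ.injective]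

/-- A local property is given by a set of forbidden matrices closed under row permutations. -/
lemma IsLocalProperty.exists_forbidden [Field F] {P : Set (Code F n)} (hP : IsLocalProperty l P) :
    ∃ S : Set (Matrix (Fin n) (Fin l) F), (∀ A ∈ S, ∀ B ∈ rowOrbit A, B ∈ S) ∧
      ∀ C, C ∈ P ↔ ∀ A ∈ S, ¬ Contains C A := by
  obtain ⟨T, -, hT⟩ := hP
  refine ⟨{A | ∃ τ ∈ T, A ∈ typeClass n τ}, ?_, ?_⟩
  · rintro A ⟨τ, hτ, hA⟩ B hB
    refine ⟨τ, hτ, fun x => ?_⟩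
    rw [empDist_eq_of_mem_rowOrbit hB, hA x]
  · intro C
    rw [hT]
    constructor
    · rintro h A ⟨τ, hτ, hA⟩
      exact h τ hτ A hA
    · intro h τ hτ A hA
      exact h A ⟨τ, hτ, hA⟩

/-- First-moment bound for one row orbit: if the random linear code of rate `k / n` avoids it with
probability at least `1 / 2`, then a linear image `A * ψ` of rank `b ≥ 1` has an orbit small enough
for the union bound over it to succeed at the lower rate `R`. -/
lemma HasContainmentBound.prob_rowOrbit_le [Field F] [Fintype F] {R ε : ℝ} {μ : PMF (Code F n)}
    (hμ : HasContainmentBound l R μ) {k : ℕ} (hk : k ≤ n) (hε : 0 ≤ ε) (hR : R ≤ k / n - ε)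
    {P : Set (Code F n)} (hP : 1 / 2 ≤ prob (rlc F n k) P) (A : Matrix (Fin n) (Fin l) F)
    (hA : ∀ C ∈ P, ∀ B ∈ rowOrbit A, ¬ Contains C B) :
    prob μ {C | ∃ B ∈ rowOrbit A, Contains C B} ≤
      (Fintype.card F : ℝ) ^ (2 * l ^ 2 + l) * (Fintype.card F : ℝ) ^ (-(n * ε)) := by
  classical
  have hq1 : (1 : ℝ) < Fintype.card F := by exact_mod_cast Fintype.one_lt_card
  have hq : (0 : ℝ) < Fintype.card F := zero_lt_one.trans hq1
  have hhalf : 2 * (Finset.univ.filter fun H : Matrix (Fin (n - k)) (Fin n) F =>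
      ∃ B ∈ rowOrbit A, H * B = 0).card ≤ Fintype.card F ^ ((n - k) * n) := by
    rw [prob_rlc, le_div_iff₀ (by positivity)] at hP
    have hdisj : Disjoint
        (Finset.univ.filter fun H : Matrix (Fin (n - k)) (Fin n) F =>
          ∃ B ∈ rowOrbit A, H * B = 0)
        (Finset.univ.filter fun H : Matrix (Fin (n - k)) (Fin n) F =>
          LinearMap.ker H.mulVecLin ∈ P) := by
      refine Finset.disjoint_filter.2 ?_
      rintro H - ⟨B, hB, h0⟩ hH
      exact hA _ hH B hB ((contains_ker_iff H B).2 h0)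
    have hle := Finset.card_le_univ (Finset.disjUnion _ _ hdisj)
    rw [Finset.card_disjUnion, card_matrix_fin] at hle
    have hle' := (Nat.cast_le (α := ℝ)).2 hle
    push_cast at hle'
    have : (2 : ℝ) * ((Finset.univ.filter fun H : Matrix (Fin (n - k)) (Fin n) F =>
      ∃ B ∈ rowOrbit A, H * B = 0).card : ℝ) ≤ (Fintype.card F : ℝ) ^ ((n - k) * n) := by
      linarith
    exact_mod_cast this
  obtain ⟨b, hb1, hbl, ψ, hrk, hcard⟩ := exists_rank_mul_eq_card_rowOrbit_le (n - k) A hhalf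
  have hsub : {C : Code F n | ∃ B ∈ rowOrbit A, Contains C B} ⊆
      ⋃ D ∈ rowOrbit (A * ψ), {C | Contains C D} := by
    rintro C ⟨B, hB, hC⟩
    simp only [Set.mem_iUnion]
    exact ⟨B * ψ, mul_mem_rowOrbit hB ψ, hC.mul_right ψ⟩
  have hn : (0 : ℝ) < n := by
    have h1 : b ≤ n := by
      rw [← hrk]
      simpa using (A * ψ).rank_le_card_height
    exact_mod_cast (by omega : 0 < n)
  calc _ ≤ ∑ D ∈ rowOrbit (A * ψ), prob μ {C | Contains C D} :=
        (prob_mono μ hsub).trans (prob_biUnion_le μ _ _)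
    _ ≤ ∑ _D ∈ rowOrbit (A * ψ), (Fintype.card F : ℝ) ^ (-((n : ℝ) * (1 - R) * (b : ℝ))) :=
        Finset.sum_le_sum fun D hD =>
          hμ b hb1 hbl D ((rank_eq_of_mem_rowOrbit hD).trans hrk)
    _ = ((rowOrbit (A * ψ)).card : ℝ) *
        (Fintype.card F : ℝ) ^ (-((n : ℝ) * (1 - R) * (b : ℝ))) := by
        rw [Finset.sum_const, nsmul_eq_mul]
    _ ≤ ((Fintype.card F : ℝ) ^ (2 * l ^ 2 + l) * (Fintype.card F : ℝ) ^ ((n - k) * b)) *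
        (Fintype.card F : ℝ) ^ (-((n : ℝ) * (1 - R) * (b : ℝ))) := by
        gcongr
        exact_mod_cast hcard
    _ = (Fintype.card F : ℝ) ^ (2 * l ^ 2 + l) *
        (Fintype.card F : ℝ) ^ (((n : ℝ) - k) * b + -((n : ℝ) * (1 - R) * (b : ℝ))) := by
        rw [mul_assoc, ← Real.rpow_natCast _ ((n - k) * b), ← Real.rpow_add hq]
        push_cast [Nat.cast_sub hk]
        rfl
    _ ≤ _ := by
        gcongr
        · exact hq1.le
        have hb : (1 : ℝ) ≤ b := by exact_mod_cast hb1
        have hRk : n * R ≤ k - n * ε := by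
          calc n * R ≤ n * (k / n - ε) := by gcongr
            _ = _ := by field_simp
        nlinarith [mul_nonneg hn.le hε]

/-- The union bound over the row orbits of forbidden matrices; there are at most `(n + 1) ^ (q ^ l)`
of them, since an orbit is determined by the multiplicities of the `q ^ l` possible rows. -/
theorem HasContainmentBound.prob_compl_le [Field F] [Fintype F] {R ε : ℝ} {μ : PMF (Code F n)}
    (hμ : HasContainmentBound l R μ) {k : ℕ} (hk : k ≤ n) (hε : 0 ≤ ε) (hR : R ≤ k / n - ε)
    {P : Set (Code F n)} (hP : 1 / 2 ≤ prob (rlc F n k) P) (hloc : IsLocalProperty l P) :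
    prob μ Pᶜ ≤ ((n : ℝ) + 1) ^ (Fintype.card F ^ l) *
      ((Fintype.card F : ℝ) ^ (2 * l ^ 2 + l) * (Fintype.card F : ℝ) ^ (-(n * ε))) := by
  classical
  obtain ⟨S, hS, hPS⟩ := hloc.exists_forbidden
  set δ := (Fintype.card F : ℝ) ^ (2 * l ^ 2 + l) * (Fintype.card F : ℝ) ^ (-(n * ε))
  have hδ : 0 ≤ δ := by positivity
  let mult : Matrix (Fin n) (Fin l) F → (Fin l → F) → Fin (n + 1) := fun A x =>
    ⟨(Finset.univ.filter fun i => A.row i = x).card,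
      Nat.lt_succ_of_le ((Finset.card_le_univ _).trans_eq (Fintype.card_fin n))⟩
  let E : ((Fin l → F) → Fin (n + 1)) → Set (Code F n) := fun c =>
    {C | ∃ A ∈ S, mult A = c ∧ Contains C A}
  -- `E c` is contained in the event of any single orbit with row multiplicities `c`
  have hE : ∀ c, prob μ (E c) ≤ δ := by
    intro c
    by_cases hc : ∃ A ∈ S, mult A = c
    · obtain ⟨A, hAS, rfl⟩ := hc
      refine (prob_mono μ ?_).trans (hμ.prob_rowOrbit_le hk hε hR hP A ?_)
      · rintro C ⟨B, -, hBA, hC⟩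
        refine ⟨B, mem_rowOrbit_of_card_eq fun x => ?_, hC⟩
        exact (congrArg Fin.val (congrFun hBA x)).symm
      · intro C hC B hB
        exact (hPS C).1 hC B (hS A hAS B hB)
    · have : E c = ∅ := by
        refine Set.eq_empty_of_forall_notMem ?_
        rintro C ⟨A, hA, hAc, -⟩
        exact hc ⟨A, hA, hAc⟩
      rw [this]
      simpa [prob] using hδ
  have hsub : Pᶜ ⊆ ⋃ c ∈ (Finset.univ : Finset ((Fin l → F) → Fin (n + 1))), E c := by
    intro C hC
    have hC' : ∃ A ∈ S, Contains C A := by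
      by_contra! h
      exact hC ((hPS C).2 h)
    obtain ⟨A, hA, hCA⟩ := hC'
    simp only [Set.mem_iUnion]
    exact ⟨mult A, Finset.mem_univ _, A, hA, rfl, hCA⟩
  calc prob μ Pᶜ ≤ ∑ c : (Fin l → F) → Fin (n + 1), prob μ (E c) :=
        (prob_mono μ hsub).trans (prob_biUnion_le μ _ _)
    _ ≤ ∑ _c : (Fin l → F) → Fin (n + 1), δ := Finset.sum_le_sum fun c _ => hE c
    _ = _ := by simp

/-- The supremum defining a positive threshold rate is attained. -/
lemma exists_rate_eq_thresholdRate [Field F] [Fintype F] {P : Set (Code F n)} (h : 0 < thresholdRate P) :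
    ∃ k ≤ n, thresholdRate P = k / n ∧ 1 / 2 ≤ prob (rlc F n k) P := by
  set Q := {R : ℝ | ∃ k : ℕ, k ≤ n ∧ R = (k : ℝ) / (n : ℝ) ∧ 1 / 2 ≤ prob (rlc F n k) P}
  have hfin : Q.Finite := by
    refine ((Finset.range (n + 1)).finite_toSet.image fun k : ℕ => (k : ℝ) / (n : ℝ)).subset ?_
    rintro R ⟨k, hk, rfl, -⟩
    exact ⟨k, by simpa using Nat.lt_succ_of_le hk, rfl⟩
  have hne : Q.Nonempty := by
    by_contra hne
    have : thresholdRate P = sSup Q := rfl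
    rw [Set.not_nonempty_iff_eq_empty.1 hne, Real.sSup_empty] at this
    exact h.ne' this
  obtain ⟨k, hk, hR, hp⟩ := hne.csSup_mem hfin
  exact ⟨k, hk, hR, hp⟩

end Threshold

/-! ### The error term -/

/-- The loss `η` in the exponent: `(n + 1) ^ (q ^ l) * q ^ (2 l² + l) = q ^ (n η)`. -/
noncomputable def rateLoss (q l n : ℕ) : ℝ :=
  ((q : ℝ) ^ l * Real.logb q (n + 1) + (2 * l ^ 2 + l)) / n

lemma rateLoss_nonneg {q : ℕ} (hq : 2 ≤ q) (l n : ℕ) : 0 ≤ rateLoss q l n := by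
  have hq' : (1 : ℝ) < q := by exact_mod_cast hq
  have := Real.logb_nonneg hq' (x := (n : ℝ) + 1) (by simp)
  unfold rateLoss
  positivity

lemma two_mul_sq_add_le (l : ℕ) : 2 * l ^ 2 + 5 * l + 7 ≤ 8 * 2 ^ l := by
  induction l with
  | zero => norm_num
  | succ l ih => rw [pow_succ 2]; nlinarith

lemma rateLoss_le {q l n : ℕ} (hq : 2 ≤ q) (hn : 3 ≤ n) :
    rateLoss q l n ≤ 10 * ((n : ℝ) / Real.logb q n / (q : ℝ) ^ (2 * l))⁻¹ + 8 * (n : ℝ)⁻¹ := by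
  have hq' : (1 : ℝ) < q := by exact_mod_cast hq
  have hq2 : (2 : ℝ) ≤ q := by exact_mod_cast hq
  have hn3 : (3 : ℝ) ≤ n := by exact_mod_cast hn
  have hn0 : (0 : ℝ) < n := by linarith
  have hlogq : 0 < Real.log q := Real.log_pos hq'
  have hlogn : 1 ≤ Real.log n := by
    rw [Real.le_log_iff_exp_le hn0]
    linarith [Real.exp_one_lt_d9]
  have hlg : 0 < Real.logb q n := Real.logb_pos hq' (by linarith)
  set x : ℝ := (q : ℝ) ^ l
  have hx1 : 1 ≤ x := one_le_pow₀ hq'.le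
  have hxx : (q : ℝ) ^ (2 * l) = x ^ 2 := by simp only [x]; ring
  have hxl : 1 ≤ x * Real.logb q n ∨ x = 1 := by
    rcases Nat.eq_zero_or_pos l with rfl | hl
    · right; simp [x]
    · left
      have hqx : (q : ℝ) ≤ x := le_self_pow₀ hq'.le hl.ne'
      have := Real.log_le_self (x := q) (by linarith)
      rw [Real.logb, ← mul_div_assoc, le_div_iff₀ hlogq]
      nlinarith
  have hsucc : Real.logb q (n + 1) ≤ 2 * Real.logb q n := by
    have h2 : (2 : ℝ) * Real.logb q n = Real.logb q ((n : ℝ) ^ 2) := by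
      rw [Real.logb_pow]
      norm_num
    rw [h2]
    refine Real.logb_le_logb_of_le hq' (by linarith) ?_
    nlinarith
  have hl : 2 * (l : ℝ) ^ 2 + l ≤ 8 * x := by
    have h1 : ((2 * l ^ 2 + 5 * l + 7 : ℕ) : ℝ) ≤ ((8 * 2 ^ l : ℕ) : ℝ) :=
      Nat.cast_le.2 (two_mul_sq_add_le l)
    push_cast at h1
    have h2 : (2 : ℝ) ^ l ≤ x := pow_le_pow_left₀ (by norm_num) hq2 l
    have h3 : (0 : ℝ) ≤ l := Nat.cast_nonneg l
    linarith
  have hx : x ≤ x ^ 2 * Real.logb q n + 1 := by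
    rcases hxl with h | h
    · nlinarith
    · rw [h]; linarith
  have hsq : x * Real.logb q (n + 1) ≤ 2 * (x ^ 2 * Real.logb q n) := by
    calc x * Real.logb q (n + 1) ≤ x * (2 * Real.logb q n) := by gcongr
      _ ≤ x ^ 2 * (2 * Real.logb q n) := by
        gcongr
        nlinarith
      _ = _ := by ring
  have hrhs : 10 * ((n : ℝ) / Real.logb q n / (q : ℝ) ^ (2 * l))⁻¹ + 8 * (n : ℝ)⁻¹ =
      (10 * (x ^ 2 * Real.logb q n) + 8) / n := by
    rw [hxx]
    field_simp
  rw [hrhs, rateLoss]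
  exact div_le_div_of_nonneg_right (by linarith) hn0.le

lemma tendsto_rateLoss {q l : ℕ → ℕ} (hq : ∀ n, 2 ≤ q n)
    (h : Tendsto (fun n : ℕ => ((n : ℝ) / Real.logb (q n : ℝ) (n : ℝ)) / (q n : ℝ) ^ (2 * l n))
      atTop atTop) :
    Tendsto (fun n => rateLoss (q n) (l n) n) atTop (𝓝 0) := by
  have h1 := (h.inv_tendsto_atTop.const_mul 10).add
    ((tendsto_natCast_atTop_atTop (R := ℝ)).inv_tendsto_atTop.const_mul 8)
  rw [mul_zero, mul_zero, add_zero] at h1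
  refine squeeze_zero' (Eventually.of_forall fun n => rateLoss_nonneg (hq n) _ _) ?_ h1
  filter_upwards [eventually_ge_atTop 3] with n hn
  exact rateLoss_le (hq n) hn

lemma pow_mul_pow_eq_rpow_rateLoss {q n : ℕ} (hq : 2 ≤ q) (hn : 0 < n) (l : ℕ) :
    ((n : ℝ) + 1) ^ (q ^ l) * (q : ℝ) ^ (2 * l ^ 2 + l) = (q : ℝ) ^ (n * rateLoss q l n) := by
  have hq1 : (1 : ℝ) < q := by exact_mod_cast hq
  have hq0 : (0 : ℝ) < q := by linarith
  have hn0 : (0 : ℝ) < n := by exact_mod_cast hn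
  rw [rateLoss, mul_div_cancel₀ _ hn0.ne', Real.rpow_add hq0]
  congr 1
  · rw [mul_comm, Real.rpow_mul hq0.le, Real.rpow_logb hq0 hq1.ne' (by positivity)]
    exact_mod_cast rfl
  · rw [← Real.rpow_natCast]
    push_cast
    rfl

end LocalSim

theorem mainTheorem9 :
    (∀ (n ℓ : ℕ) (F : Type u) [Field F] [Fintype F] (μ : PMF (LocalSim.Code F n)) (R : ℝ),
      R ∈ Set.Icc (0 : ℝ) 1 → LocalSim.HasContainmentBound ℓ R μ →
        LocalSim.IsLocallySimilar ℓ R μ) ∧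
    (∀ q ℓ : ℕ → ℕ, (∀ n, IsPrimePow (q n)) →
      Tendsto (fun n : ℕ => ((n : ℝ) / Real.logb (q n : ℝ) (n : ℝ)) / (q n : ℝ) ^ (2 * ℓ n))
        atTop atTop →
      ∃ η : ℕ → ℝ, Tendsto η atTop (𝓝 0) ∧
        ∀ (n : ℕ) (F : Type u) [Field F] [Fintype F], Fintype.card F = q n →
          ∀ (μ : PMF (LocalSim.Code F n)) (R : ℝ), R ∈ Set.Icc (0 : ℝ) 1 →
            LocalSim.HasContainmentBound (ℓ n) R μ →
            ∀ (P : Set (LocalSim.Code F n)) (ε : ℝ), LocalSim.IsLocalProperty (ℓ n) P →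
              R ≤ LocalSim.thresholdRate P - ε →
              LocalSim.prob μ Pᶜ ≤ (q n : ℝ) ^ (-((n : ℝ) * (ε - η n)))) := by
  refine ⟨fun n ℓ F _ _ μ R _ hμ => hμ.isLocallySimilar, fun q ℓ hq hlim => ?_⟩
  have hq2 : ∀ n, 2 ≤ q n := fun n => (hq n).two_le
  refine ⟨fun n => LocalSim.rateLoss (q n) (ℓ n) n, LocalSim.tendsto_rateLoss hq2 hlim, ?_⟩
  intro n F _ _ hF μ R hR hμ P ε hP hRε
  have hq1 : (1 : ℝ) < q n := by exact_mod_cast hq2 n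
  have hq0 : (0 : ℝ) < q n := by linarith
  rcases Nat.eq_zero_or_pos n with rfl | hn
  · simpa using LocalSim.prob_le_one μ Pᶜ
  rcases le_or_gt ε 0 with hε | hε
  · -- the bound is at least `1`
    refine (LocalSim.prob_le_one μ Pᶜ).trans (Real.one_le_rpow hq1.le ?_)
    have := LocalSim.rateLoss_nonneg (hq2 n) (ℓ n) n
    have hn0 : (0 : ℝ) ≤ n := Nat.cast_nonneg n
    nlinarith
  obtain ⟨k, hk, hthr, hhalf⟩ :=
    LocalSim.exists_rate_eq_thresholdRate (P := P) (by linarith [hR.1])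
  rw [hthr] at hRε
  refine (hμ.prob_compl_le hk hε.le hRε hhalf hP).trans_eq ?_
  rw [hF, ← mul_assoc, LocalSim.pow_mul_pow_eq_rpow_rateLoss (hq2 n) hn, ← Real.rpow_add hq0]
  ring_nf
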